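/- Let $a<b$ and let $H$ be a random element of $\mathcal C([a,b])$ (uniform norm, Borel $\sigma$-algebra) on a probability space $(\Omega,\mathcal A,\mathbf P)$ such that almost surely $H$ is strictly increasing, $H(a)=a$ and $H(b)=b$. Let $\phi(t)=\mathbf E[H(t)]$, and let $h_1,h_2,\dots$ be independent copies of $H$. Let $f:[a,b]\to\mathbb R$ be continuous and strictly increasing, and let $f_{ES}=f\circ\phi^{-1}$ be the structural expectation, so that $f_{ES}^{-1}=\phi\circ f^{-1}$ on $[f(a),f(b)]$. For every $m\ge 1$, each of the curves $f\circ h_i^{-1}$, $i=1,\dots,m$, is observed at $n=n_m$ equidistant times $t_{i1}<\dots<t_{in}$ of $[a,b]$ (which may depend on $m$) running through $[a,b]$: for some spacing $d>0$, $t_{i,j+1}-t_{ij}=d$ for all $j$, $t_{i1}\le a+d$ and $t_{in}\ge b-d$. Put $Y_{ij}=f(h_i^{-1}(t_{ij}))$. Assume that, for some constants $c,\beta>0$, $n_m\ge c\,m^{1/2+\beta}$ for all large $m$ (for example $n_m=\lfloor m^{1/2+\beta}\rfloor$). For $y\in[f(a),f(b)]$ let $T_i(y)=t_{i\,j_i(y)}$,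 where $j_i(y)$ is an index $j\in\{1,\dots,n\}$ minimizing $|Y_{ij}-y|$ (ties broken in any way), and $$\widehat{f_{ES}^{-1}}(y)=\frac1m\sum_{i=1}^m T_i(y),\qquad \widehat{\mathrm{var}}(G(y))=\frac1m\sum_{i=1}^m T_i(y)^2-\Big(\widehat{f_{ES}^{-1}}(y)\Big)^2 .$$ Here $G$ denotes the limiting centered Gaussian process of $\sqrt m\,(\widehat{f_{ES}^{-1}}-f_{ES}^{-1})$, with $\mathrm{var}(G(y))=\mathrm{var}\big(H(f^{-1}(y))\big)$; only the estimator $\widehat{\mathrm{var}}(G(y))$ is used below. Let $0<\alpha<1$ and let $u_{1-\alpha/2}$ be the quantile of order $1-\frac\alpha2$ of the standard normal distribution. Then $$I_m(y)=\left[\widehat{f_{ES}^{-1}}(y)-u_{1-\frac\alpha2}\sqrt{\frac{\widehat{\mathrm{var}}(G(y))}{m}},\ \widehat{f_{ES}^{-1}}(y)+u_{1-\frac\alpha2}\sqrt{\frac{\widehat{\mathrm{var}}(G(y))}{m}}\right]$$ is an asymptotic $(1-\alpha)$-level pointwise confidence band for $f_{ES}^{-1}$: for every $y\in[f(a),f(b)]$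 with $\mathrm{var}(H(f^{-1}(y)))>0$, $$\mathbf P\big(f_{ES}^{-1}(y)\in I_m(y)\big)\longrightarrow 1-\alpha\qquad(m\to\infty).$$ At the end points $y=f(a)$ and $y=f(b)$, where this variance is zero, one has $\mathbf P\big(f_{ES}^{-1}(y)\in I_m(y)\big)=1$ for every $m\ge1$ such that the observation times of each of the $m$ curves contain $a$ and $b$. -/

import Mathlib

open MeasureTheory ProbabilityTheory Filter Topology

noncomputable section

namespace Warping

/-- A path of the warping process: a strictly increasing continuous function on `[a, b]`
which fixes the two end points. -/
def IsWarp {a b : ℝ} (hab : a < b) (w : C(Set.Icc a b, ℝ)) : Prop :=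
  StrictMono w ∧ w ⟨a, Set.left_mem_Icc.2 hab.le⟩ = a ∧ w ⟨b, Set.right_mem_Icc.2 hab.le⟩ = b

/-- The path `w` as a function of a real argument; only its values on `[a, b]`, where it is `w`,
matter. -/
def path {a b : ℝ} (hab : a < b) (w : C(Set.Icc a b, ℝ)) : ℝ → ℝ :=
  Set.IccExtend hab.le w

/-- The inverse of `g`, seen as a function on `[a, b]`: if `g` is injective on `[a, b]` and
`s ∈ [a, b]`, it maps `g s` to `s`. -/
def inv (a b : ℝ) (g : ℝ → ℝ) : ℝ → ℝ :=
  Function.invFunOn g (Set.Icc a b)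

/-- The expectation `φ(t) = E[H(t)]` of the warping process. -/
def meanWarp {Ω : Type*} [MeasurableSpace Ω] (P : Measure Ω) {a b : ℝ} (hab : a < b)
    (H : Ω → C(Set.Icc a b, ℝ)) (t : ℝ) : ℝ :=
  ∫ ω, path hab (H ω) t ∂P

/-- The structural expectation `f_ES = f ∘ φ⁻¹`. -/
def structuralExpectation {Ω : Type*} [MeasurableSpace Ω] (P : Measure Ω) {a b : ℝ} (hab : a < b)
    (H : Ω → C(Set.Icc a b, ℝ)) (f : ℝ → ℝ) : ℝ → ℝ :=
  f ∘ inv a b (meanWarp P hab H)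

/-- The `n` times `t` are equidistant points of `[a, b]` with some spacing `d`, and run through
the whole interval: the first and the last one are at distance at most `d` from `a` and `b`. -/
def IsEquidistant (a b : ℝ) {n : ℕ} (t : Fin n → ℝ) : Prop :=
  ∃ s d : ℝ, 0 < d ∧ a ≤ s ∧ s ≤ a + d ∧
    b - d ≤ s + ((n : ℝ) - 1) * d ∧ s + ((n : ℝ) - 1) * d ≤ b ∧
    ∀ j : Fin n, t j = s + (j : ℝ) * d

/-- `τ = t j` for some index `j` which minimizes `|Y j - y|`. -/
def IsNearestTime {n : ℕ} (t Y : Fin n → ℝ) (y τ : ℝ) : Prop :=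
  ∃ j : Fin n, (∀ k : Fin n, |Y j - y| ≤ |Y k - y|) ∧ τ = t j

/-- The empirical mean of `τ 0, …, τ (m - 1)`: the estimator of `f_ES⁻¹(y)`. -/
def invEst (m : ℕ) (τ : ℕ → ℝ) : ℝ :=
  (1 / (m : ℝ)) * ∑ i ∈ Finset.range m, τ i

/-- The empirical second moment: the estimator of `γ ∘ f⁻¹ (y)`. -/
def secondMomentEst (m : ℕ) (τ : ℕ → ℝ) : ℝ :=
  (1 / (m : ℝ)) * ∑ i ∈ Finset.range m, τ i ^ 2

/-- The estimator of `var (G(y))`. -/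
def varEst (m : ℕ) (τ : ℕ → ℝ) : ℝ :=
  secondMomentEst m τ - invEst m τ ^ 2

/-- The quantile of order `p` of a probability measure on `ℝ`. -/
def quantile (μ : Measure ℝ) (p : ℝ) : ℝ :=
  sInf {x : ℝ | p ≤ cdf μ x}

/-- The confidence interval with nominal level `1 - α` computed from `τ 0, …, τ (m - 1)`. -/
def confInterval (α : ℝ) (m : ℕ) (τ : ℕ → ℝ) : Set ℝ :=
  Set.Icc
    (invEst m τ - quantile (gaussianReal 0 1) (1 - α / 2) * √(varEst m τ / (m : ℝ)))
    (invEst m τ + quantile (gaussianReal 0 1) (1 - α / 2) * √(varEst m τ / (m : ℝ)))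

end Warping

end

/-! # Asymptotic level of the confidence band for the inverse of the structural expectation

Let `y = f x` with `x ∈ [a, b]`. The mean `φ` of the warping process is again a strictly increasing
continuous function fixing `a` and `b`, so the inverse of `f ∘ φ⁻¹` at `y` is `φ x`, the mean of the
i.i.d. bounded variables `X i = h i x` (`isTimeChange_meanWarp`, `IsTimeChange.inv_comp_inv`).
If the `X i` were observed, the interval would be the usual studentized one, of asymptotic level
`1 - α` by the central limit theorem, the law of large numbers for the empirical variance and
Slutsky's theorem (`tendstoInDistribution_pivot`).

What is observed instead is `T i`, which by monotonicity is within one spacing of `X i`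
(`IsNearestTime.abs_sub_le`). As the spacing is at most `(b - a) / (n - 1) = o(m ^ (-1/2))`, the
pivot of the interval moves by a deterministic quantity tending to zero (`abs_pivot_sub_le`).
A choice of `T i` among ties need not be measurable, so the coverage event is squeezed between two
measurable events, given by the unperturbed pivot being below `∓ c m` with `c m → 0`
(`tendsto_measureReal_of_tendstoInDistribution`). Both have the same limiting probability because
the normal law has no atoms.

At the end points every `X i` is the end point itself, which is then the only nearest observation
time (`IsNearestTime.eq_of_mem`), and the data are constant.
-/

namespace Warping

/-! ### The normal quantile -/

/-- Without atoms the distribution function is continuous, so that the quantile is a point where it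
takes the value `p`. -/
lemma cdf_quantile (μ : Measure ℝ) [IsProbabilityMeasure μ] [NullSingletonClass μ] {p : ℝ}
    (hp : p ∈ Set.Ioo (0 : ℝ) 1) : cdf μ (quantile μ p) = p := by
  have hcont : Continuous (cdf μ) := by
    refine continuous_iff_continuousAt.2 fun x => ?_
    rw [continuousAt_iff_continuous_left'_right']
    refine ⟨?_, ((cdf μ).right_continuous x).mono Set.Ioi_subset_Ici_self⟩
    have h0 := (cdf μ).measure_singleton x
    rw [measure_cdf, measure_singleton, eq_comm, ENNReal.ofReal_eq_zero, sub_nonpos] at h0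
    have := (monotone_cdf μ).tendsto_leftLim x
    rwa [le_antisymm ((monotone_cdf μ).leftLim_le le_rfl) h0] at this
  obtain ⟨x₁, hx₁⟩ := ((tendsto_cdf_atTop μ).eventually_const_lt hp.2).exists
  obtain ⟨x₀, hx₀⟩ := ((tendsto_cdf_atBot μ).eventually_lt_const hp.1).exists
  have hbdd : BddBelow {x : ℝ | p ≤ cdf μ x} :=
    ⟨x₀, fun x hx => le_of_not_gt fun hlt =>
      absurd (hx.trans (monotone_cdf μ hlt.le)) (not_le.2 hx₀)⟩
  have hclosed : IsClosed {x : ℝ | p ≤ cdf μ x} := isClosed_le continuous_const hcont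
  refine le_antisymm ?_ (hclosed.csInf_mem ⟨x₁, hx₁.le⟩ hbdd)
  have hlim : Tendsto (cdf μ) (𝓝[<] quantile μ p) (𝓝 (cdf μ (quantile μ p))) :=
    (hcont.tendsto _).mono_left nhdsWithin_le_nhds
  refine le_of_tendsto hlim (eventually_nhdsWithin_of_forall fun z hz => ?_)
  exact le_of_not_ge fun hle => absurd (csInf_le hbdd hle) (not_le.2 hz)

instance nullSingletonClass_stdGaussian : NullSingletonClass (gaussianReal 0 1) :=
  nullSingletonClass_gaussianReal one_ne_zero

lemma gaussianReal_Iic_quantile {α : ℝ} (hα : α ∈ Set.Ioo (0 : ℝ) 1) :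
    (gaussianReal 0 1).real (Set.Iic (quantile (gaussianReal 0 1) (1 - α / 2))) = 1 - α / 2 := by
  rw [← cdf_eq_real]
  exact cdf_quantile _ ⟨by linarith [hα.2], by linarith [hα.1]⟩

/-- By symmetry of the standard normal law, the lower tail has the mass of the upper one. -/
lemma gaussianReal_Iio_neg_quantile {α : ℝ} (hα : α ∈ Set.Ioo (0 : ℝ) 1) :
    (gaussianReal 0 1).real (Set.Iio (-quantile (gaussianReal 0 1) (1 - α / 2))) = α / 2 := by
  set u := quantile (gaussianReal 0 1) (1 - α / 2)
  have h1 : (gaussianReal 0 1).real (Set.Iio (-u)) = (gaussianReal 0 1).real (Set.Iic u)ᶜ := by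
    conv_rhs => rw [← neg_zero, ← gaussianReal_map_neg]
    rw [map_measureReal_apply measurable_neg measurableSet_Iic.compl]
    congr 1
    ext x
    simp only [Set.mem_Iio, Set.mem_preimage, Set.mem_compl_iff, Set.mem_Iic, not_le]
    exact lt_neg
  rw [h1, probReal_compl_eq_one_sub measurableSet_Iic, gaussianReal_Iic_quantile hα]
  ring

lemma quantile_gaussianReal_nonneg {α : ℝ} (hα : α ∈ Set.Ioo (0 : ℝ) 1) :
    0 ≤ quantile (gaussianReal 0 1) (1 - α / 2) := by
  by_contra! hu
  have hle := measureReal_mono (μ := gaussianReal 0 1)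
    (Set.Iic_subset_Iio.2 (by linarith) :
      Set.Iic (quantile (gaussianReal 0 1) (1 - α / 2)) ⊆
        Set.Iio (-quantile (gaussianReal 0 1) (1 - α / 2)))
  rw [gaussianReal_Iic_quantile hα, gaussianReal_Iio_neg_quantile hα] at hle
  linarith [hα.2]

lemma gaussianReal_abs_le_quantile {α : ℝ} (hα : α ∈ Set.Ioo (0 : ℝ) 1) :
    (gaussianReal 0 1).real {x | |x| ≤ quantile (gaussianReal 0 1) (1 - α / 2)} = 1 - α := by
  have hu := quantile_gaussianReal_nonneg hα
  set u := quantile (gaussianReal 0 1) (1 - α / 2) with hu_def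
  have hset : {x : ℝ | |x| ≤ u} = Set.Iic u \ Set.Iio (-u) := by
    ext x
    simp only [Set.mem_ofPred_eq, Set.mem_sdiff, Set.mem_Iic, Set.mem_Iio, not_lt, abs_le]
    exact and_comm
  rw [hset, measureReal_sdiff (Set.Iio_subset_Iic_self.trans (Set.Iic_subset_Iic.2 (by linarith)))
      measurableSet_Iio,
    hu_def, gaussianReal_Iic_quantile hα, gaussianReal_Iio_neg_quantile hα]
  ring

/-! ### Sandwiching a possibly non-measurable event -/

/-- If the events `A m` are squeezed, up to `c m → 0`, between sublevel sets of variables which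
converge in distribution, then their outer probabilities converge. The sets `A m` need not be
measurable. -/
lemma tendsto_measureReal_of_tendstoInDistribution {Ω Ω' : Type*} [MeasurableSpace Ω]
    [MeasurableSpace Ω'] {P : Measure Ω} [IsProbabilityMeasure P] {P' : Measure Ω'}
    [IsProbabilityMeasure P'] {D : ℕ → Ω → ℝ} {D' : Ω' → ℝ}
    (hD : TendstoInDistribution D atTop D' (fun _ => P) P') (h0 : P' {ω | D' ω = 0} = 0)
    {A : ℕ → Set Ω} {c : ℕ → ℝ} (hc : Tendsto c atTop (𝓝 0))
    (hA : ∀ᶠ m in atTop, ∀ᵐ ω ∂P, (D m ω + c m ≤ 0 → ω ∈ A m) ∧ (ω ∈ A m → D m ω - c m ≤ 0)) :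
    Tendsto (fun m => P.real (A m)) atTop (𝓝 (P'.real {ω | D' ω ≤ 0})) := by
  have key : ∀ e : ℕ → ℝ, Tendsto e atTop (𝓝 0) →
      Tendsto (fun m => P.real {ω | D m ω + e m ≤ 0}) atTop (𝓝 (P'.real {ω | D' ω ≤ 0})) := by
    intro e he
    have hsum := hD.add_of_tendstoInMeasure_const (Y := fun m _ => e m) (c := 0)
      (tendstoInMeasure_of_tendsto_ae (fun _ => aestronglyMeasurable_const)
        (ae_of_all _ fun _ => he)) (fun _ => aemeasurable_const)
    simp only [add_zero] at hsum
    have hfr : (P'.map D') (frontier (Set.Iic (0 : ℝ))) = 0 := by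
      rw [frontier_Iic, Measure.map_apply_of_aemeasurable hD.aemeasurable_limit
        (measurableSet_singleton 0)]
      exact h0
    have hlim := ProbabilityMeasure.tendsto_measure_of_null_frontier_of_tendsto' hsum.tendsto hfr
    simp only [ProbabilityMeasure.coe_mk,
      Measure.map_apply_of_aemeasurable hD.aemeasurable_limit measurableSet_Iic] at hlim
    refine ((ENNReal.tendsto_toReal (measure_ne_top P' _)).comp hlim).congr fun m => ?_
    simp only [Function.comp_apply,
      Measure.map_apply_of_aemeasurable (hsum.forall_aemeasurable m) measurableSet_Iic]
    rfl
  refine tendsto_of_tendsto_of_tendsto_of_le_of_le' (key c hc)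
    (key (fun m => -c m) (by simpa using hc.neg)) ?_ ?_
  · filter_upwards [hA] with m hm
    refine ENNReal.toReal_mono (measure_ne_top _ _) (measure_mono_ae ?_)
    filter_upwards [hm] with ω hω using hω.1
  · filter_upwards [hA] with m hm
    refine ENNReal.toReal_mono (measure_ne_top _ _) (measure_mono_ae ?_)
    filter_upwards [hm] with ω hω hmem
    exact (sub_eq_add_neg (D m ω) (c m)).symm.trans_le (hω.2 hmem)

/-! ### The pivot of the confidence interval and its perturbation -/

/-- The pivot of the interval with half-width `u * √(varEst / m)`: for `1 ≤ m` the interval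
contains `θ` if and only if the pivot is nonpositive. -/
noncomputable def pivot (u θ : ℝ) (m : ℕ) (x : ℕ → ℝ) : ℝ :=
  |√(m : ℝ) * (invEst m x - θ)| - u * √(varEst m x)

lemma mem_confInterval_iff (α θ : ℝ) {m : ℕ} (hm : 1 ≤ m) (x : ℕ → ℝ) :
    θ ∈ confInterval α m x ↔
      pivot (quantile (gaussianReal 0 1) (1 - α / 2)) θ m x ≤ 0 := by
  have hm' : (0 : ℝ) < √(m : ℝ) := Real.sqrt_pos.2 (by exact_mod_cast hm)
  rw [confInterval, pivot, Real.sqrt_div' _ (Nat.cast_nonneg m), abs_mul, abs_of_pos hm',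
    sub_nonpos, ← mul_div_assoc, ← le_div_iff₀' hm', abs_le, Set.mem_Icc]
  constructor <;> rintro ⟨h1, h2⟩ <;> constructor <;> linarith

lemma abs_mean_sub_mean_le {m : ℕ} {x y : ℕ → ℝ} {δ : ℝ} (hm : 1 ≤ m)
    (h : ∀ i < m, |x i - y i| ≤ δ) :
    |1 / (m : ℝ) * ∑ i ∈ Finset.range m, x i - 1 / (m : ℝ) * ∑ i ∈ Finset.range m, y i| ≤ δ := by
  have hm' : (0 : ℝ) < m := by exact_mod_cast hm
  rw [← mul_sub, ← Finset.sum_sub_distrib, abs_mul, abs_of_pos (by positivity : 0 < 1 / (m : ℝ)),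
    one_div, inv_mul_le_iff₀ hm']
  refine (Finset.abs_sum_le_sum_abs _ _).trans ?_
  refine (Finset.sum_le_sum fun i hi => h i (Finset.mem_range.1 hi)).trans ?_
  simp

lemma abs_invEst_le {m : ℕ} {x : ℕ → ℝ} {C : ℝ} (hm : 1 ≤ m) (h : ∀ i < m, |x i| ≤ C) :
    |invEst m x| ≤ C := by
  have := abs_mean_sub_mean_le (y := fun _ => 0) hm (by simpa using h)
  simpa [invEst] using this

lemma abs_sq_sub_sq_le {x y C δ : ℝ} (hx : |x| ≤ C) (hy : |y| ≤ C) (h : |x - y| ≤ δ) :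
    |x ^ 2 - y ^ 2| ≤ 2 * C * δ := by
  rw [sq_sub_sq, abs_mul]
  exact mul_le_mul ((abs_add_le x y).trans (by linarith)) h (abs_nonneg _)
    (by linarith [abs_nonneg x])

lemma abs_varEst_sub_le {m : ℕ} {x y : ℕ → ℝ} {C δ : ℝ} (hm : 1 ≤ m)
    (hx : ∀ i < m, |x i| ≤ C) (hy : ∀ i < m, |y i| ≤ C) (h : ∀ i < m, |x i - y i| ≤ δ) :
    |varEst m x - varEst m y| ≤ 4 * C * δ := by
  have h1 : |secondMomentEst m x - secondMomentEst m y| ≤ 2 * C * δ :=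
    abs_mean_sub_mean_le hm fun i hi => abs_sq_sub_sq_le (hx i hi) (hy i hi) (h i hi)
  have h2 : |invEst m x ^ 2 - invEst m y ^ 2| ≤ 2 * C * δ :=
    abs_sq_sub_sq_le (abs_invEst_le hm hx) (abs_invEst_le hm hy) (abs_mean_sub_mean_le hm h)
  have h3 : varEst m x - varEst m y =
      (secondMomentEst m x - secondMomentEst m y) - (invEst m x ^ 2 - invEst m y ^ 2) := by
    simp only [varEst]; ring
  rw [h3]
  exact (abs_sub _ _).trans (by linarith)

lemma abs_sqrt_sub_sqrt_le_sqrt_abs (x y : ℝ) : |√x - √y| ≤ √|x - y| := by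
  have key : ∀ x y : ℝ, √x ≤ √y + √|x - y| := by
    intro x y
    rcases le_total x 0 with hx | hx
    · rw [Real.sqrt_eq_zero_of_nonpos hx]; positivity
    refine Real.sqrt_le_iff.2 ⟨by positivity, ?_⟩
    have h1 : y ≤ √y ^ 2 := by
      rcases le_total y 0 with hy | hy
      · exact hy.trans (sq_nonneg _)
      · rw [Real.sq_sqrt hy]
    have h2 := Real.sq_sqrt (abs_nonneg (x - y))
    nlinarith [le_abs_self (x - y), Real.sqrt_nonneg y, Real.sqrt_nonneg |x - y|,
      mul_nonneg (Real.sqrt_nonneg y) (Real.sqrt_nonneg |x - y|)]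
  rw [abs_le]
  have h1 := key x y
  have h2 := key y x
  rw [abs_sub_comm] at h2
  constructor <;> linarith

lemma abs_pivot_sub_le {u θ C δ : ℝ} {m : ℕ} {x y : ℕ → ℝ} (hu : 0 ≤ u) (hm : 1 ≤ m)
    (hx : ∀ i < m, |x i| ≤ C) (hy : ∀ i < m, |y i| ≤ C) (h : ∀ i < m, |x i - y i| ≤ δ) :
    |pivot u θ m x - pivot u θ m y| ≤ √(m : ℝ) * δ + u * √(4 * C * δ) := by
  have h1 : |(|√(m : ℝ) * (invEst m x - θ)| - |√(m : ℝ) * (invEst m y - θ)|)| ≤ √(m : ℝ) * δ := by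
    refine (abs_abs_sub_abs_le_abs_sub _ _).trans ?_
    rw [← mul_sub, sub_sub_sub_cancel_right, abs_mul, abs_of_nonneg (Real.sqrt_nonneg _)]
    exact mul_le_mul_of_nonneg_left (abs_mean_sub_mean_le hm h) (Real.sqrt_nonneg _)
  have h2 : |u * √(varEst m x) - u * √(varEst m y)| ≤ u * √(4 * C * δ) := by
    rw [← mul_sub, abs_mul, abs_of_nonneg hu]
    refine mul_le_mul_of_nonneg_left ((abs_sqrt_sub_sqrt_le_sqrt_abs _ _).trans ?_) hu
    exact Real.sqrt_le_sqrt (abs_varEst_sub_le hm hx hy h)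
  have h3 : pivot u θ m x - pivot u θ m y =
      (|√(m : ℝ) * (invEst m x - θ)| - |√(m : ℝ) * (invEst m y - θ)|) -
        (u * √(varEst m x) - u * √(varEst m y)) := by
    simp only [pivot]; ring
  rw [h3]
  exact (abs_sub _ _).trans (add_le_add h1 h2)

/-! ### Asymptotics of the pivot -/

section Asymptotics

variable {Ω : Type*} [MeasurableSpace Ω] {P : Measure Ω} {X : ℕ → Ω → ℝ}

lemma ae_tendsto_mean (hint : Integrable (X 0) P) (hindep : iIndepFun X P)
    (hident : ∀ i, IdentDistrib (X i) (X 0) P P) :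
    ∀ᵐ ω ∂P, Tendsto (fun m : ℕ => 1 / (m : ℝ) * ∑ i ∈ Finset.range m, X i ω) atTop
      (𝓝 (∫ ω, X 0 ω ∂P)) := by
  filter_upwards [strong_law_ae_real X hint (fun i j hij => hindep.indepFun hij) hident] with ω hω
  refine hω.congr fun m => ?_
  rw [one_div, inv_mul_eq_div]

lemma ae_tendsto_varEst [IsProbabilityMeasure P] (hX : MemLp (X 0) 2 P) (hindep : iIndepFun X P)
    (hident : ∀ i, IdentDistrib (X i) (X 0) P P) :
    ∀ᵐ ω ∂P, Tendsto (fun m : ℕ => varEst m (fun i => X i ω)) atTop (𝓝 (variance (X 0) P)) := by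
  have h1 := ae_tendsto_mean (hX.integrable (by norm_num)) hindep hident
  have h2 := ae_tendsto_mean (X := fun i ω => X i ω ^ 2) hX.integrable_sq
    (hindep.comp (fun _ x => x ^ 2) fun _ => by fun_prop)
    (fun i => (hident i).comp (u := fun x => x ^ 2) (by fun_prop))
  rw [variance_eq_sub hX]
  filter_upwards [h1, h2] with ω hω1 hω2
  exact hω2.sub (hω1.pow 2)

lemma aemeasurable_varEst (hX : ∀ i, AEMeasurable (X i) P) (m : ℕ) :
    AEMeasurable (fun ω => varEst m (fun i => X i ω)) P := by
  unfold varEst secondMomentEst invEst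
  refine (AEMeasurable.const_mul (Finset.aemeasurable_fun_sum _ fun i _ => (hX i).pow_const 2)
    _).sub ((AEMeasurable.const_mul (Finset.aemeasurable_fun_sum _ fun i _ => hX i) _).pow_const 2)

/-- The central limit theorem for the numerator and the law of large numbers for the empirical
variance combine by Slutsky's theorem. -/
lemma tendstoInDistribution_pivot [IsProbabilityMeasure P] (hX : MemLp (X 0) 2 P)
    (hindep : iIndepFun X P) (hident : ∀ i, IdentDistrib (X i) (X 0) P P) (u : ℝ) :
    TendstoInDistribution (fun m ω => pivot u (∫ ω, X 0 ω ∂P) m (fun i => X i ω)) atTop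
      (fun z : ℝ => |√(variance (X 0) P) * z| - u * √(variance (X 0) P)) (fun _ => P)
      (gaussianReal 0 1) := by
  have hlaw : HasLaw (fun z : ℝ => √(variance (X 0) P) * z)
      (gaussianReal 0 (variance (X 0) P).toNNReal) (gaussianReal 0 1) := by
    refine ⟨by fun_prop, ?_⟩
    rw [gaussianReal_map_const_mul, mul_zero, mul_one]
    congr 1
    ext
    simp [Real.sq_sqrt (variance_nonneg (X 0) P), variance_nonneg]
  have hclt := tendstoInDistribution_inv_sqrt_mul_sum_sub hlaw hX hindep hident
  have haem := aemeasurable_varEst (P := P) fun i => (hident i).aemeasurable_fst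
  have h := hclt.continuous_comp_prodMk_of_tendstoInMeasure_const
    (g := fun p : ℝ × ℝ => |p.1| - u * √p.2) (by fun_prop)
    (tendstoInMeasure_of_tendsto_ae (fun m => (haem m).aestronglyMeasurable)
      (ae_tendsto_varEst hX hindep hident)) haem
  convert! h using 4 with m ω
  rw [pivot, invEst]
  congr 2
  rcases m.eq_zero_or_pos with rfl | hm
  · simp
  have hm' : (0 : ℝ) < m := by exact_mod_cast hm
  have hs : √(m : ℝ) ≠ 0 := (Real.sqrt_pos.2 hm').ne'
  field_simp
  rw [Real.sq_sqrt hm'.le]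

/-- The interval keeps its asymptotic level when the data `X i` are replaced by `τ m i` at distance
`o(m ^ (-1/2))`. The perturbed data need not be measurable. -/
theorem tendsto_measureReal_mem_confInterval [IsProbabilityMeasure P] (hindep : iIndepFun X P)
    (hident : ∀ i, IdentDistrib (X i) (X 0) P P) {C : ℝ} (hXC : ∀ i, ∀ᵐ ω ∂P, |X i ω| ≤ C)
    (hvar : 0 < variance (X 0) P) {τ : ℕ → ℕ → Ω → ℝ} {δ : ℕ → ℝ}
    (hδ : Tendsto (fun m : ℕ => √(m : ℝ) * δ m) atTop (𝓝 0))
    (hτ : ∀ᶠ m in atTop, ∀ᵐ ω ∂P, ∀ i < m, |τ m i ω| ≤ C ∧ |τ m i ω - X i ω| ≤ δ m)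
    {α : ℝ} (hα : α ∈ Set.Ioo (0 : ℝ) 1) :
    Tendsto (fun m => P.real {ω | ∫ ω, X 0 ω ∂P ∈ confInterval α m (fun i => τ m i ω)})
      atTop (𝓝 (1 - α)) := by
  have hX : MemLp (X 0) 2 P :=
    memLp_of_bounded (a := -C) (b := C) ((hXC 0).mono fun ω hω => abs_le.1 hω)
      (hident 0).aestronglyMeasurable_fst 2
  set u := quantile (gaussianReal 0 1) (1 - α / 2) with hu_def
  have hu : 0 ≤ u := quantile_gaussianReal_nonneg hα
  set σ := √(variance (X 0) P) with hσ_def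
  have hσ : 0 < σ := Real.sqrt_pos.2 hvar
  have hδ0 : Tendsto δ atTop (𝓝 0) := by
    have := (tendsto_inv_atTop_zero.comp
      (Real.tendsto_sqrt_atTop.comp (tendsto_natCast_atTop_atTop (R := ℝ)))).mul hδ
    rw [zero_mul] at this
    refine this.congr' ?_
    filter_upwards [eventually_ge_atTop 1] with m hm
    have hs : √(m : ℝ) ≠ 0 := (Real.sqrt_pos.2 (by exact_mod_cast hm)).ne'
    simp only [Function.comp_apply]
    field_simp
  have hc : Tendsto (fun m : ℕ => √(m : ℝ) * δ m + u * √(4 * C * δ m)) atTop (𝓝 0) := by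
    have h1 : Tendsto (fun m => √(4 * C * δ m)) atTop (𝓝 0) := by
      have := (hδ0.const_mul (4 * C)).sqrt
      simpa using this
    simpa using hδ.add (h1.const_mul u)
  -- the limit of the pivot is `|σ * z| - u * σ` under the standard normal law
  have hset : ∀ z : ℝ, |σ * z| - u * σ ≤ 0 ↔ |z| ≤ u := fun z => by
    rw [abs_mul, abs_of_pos hσ, sub_nonpos, mul_comm, mul_le_mul_iff_left₀ hσ]
  have hnull : gaussianReal 0 1 {z : ℝ | |σ * z| - u * σ = 0} = 0 := by
    refine measure_mono_null (t := {u, -u}) (fun z hz => ?_)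
      ((Set.toFinite {u, -u}).measure_zero _)
    have hz' : |z| = u := by
      have hz0 : |σ * z| - u * σ = 0 := hz
      rw [abs_mul, abs_of_pos hσ, mul_comm, ← sub_mul] at hz0
      linarith [(mul_eq_zero.1 hz0).resolve_right hσ.ne']
    exact (abs_eq hu).1 hz'
  have hlim := tendsto_measureReal_of_tendstoInDistribution
    (tendstoInDistribution_pivot hX hindep hident u) hnull
    (A := fun m => {ω | ∫ ω, X 0 ω ∂P ∈ confInterval α m (fun i => τ m i ω)}) hc ?_
  · simp only [← hσ_def, hset] at hlim
    rwa [hu_def, gaussianReal_abs_le_quantile hα] at hlim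
  · filter_upwards [hτ, eventually_ge_atTop 1] with m hm hm1
    filter_upwards [hm, ae_all_iff.2 hXC] with ω hω hωX
    have hle := abs_le.1 (abs_pivot_sub_le (θ := ∫ ω, X 0 ω ∂P) hu hm1
      (fun i hi => (hω i hi).1) (fun i _ => hωX i) (fun i hi => (hω i hi).2))
    simp only [mem_confInterval_iff α _ hm1, ← hu_def]
    constructor <;> intro h' <;> linarith [hle.1, hle.2]

end Asymptotics

/-! ### Inverses on an interval -/

/-- A strictly increasing continuous function on `[a, b]` which fixes both end points; the version
of `IsWarp` for functions of a real argument, shared by the paths and by their mean. -/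
structure IsTimeChange (a b : ℝ) (g : ℝ → ℝ) : Prop where
  strictMonoOn : StrictMonoOn g (Set.Icc a b)
  continuousOn : ContinuousOn g (Set.Icc a b)
  map_left : g a = a
  map_right : g b = b

section Inverse

variable {a b : ℝ} {f g : ℝ → ℝ} {x : ℝ}

lemma inv_apply (hf : Set.InjOn f (Set.Icc a b)) (hx : x ∈ Set.Icc a b) : inv a b f (f x) = x :=
  hf.leftInvOn_invFunOn hx

lemma IsTimeChange.mem_Icc (hab : a < b) (hg : IsTimeChange a b g) (hx : x ∈ Set.Icc a b) :
    g x ∈ Set.Icc a b := by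
  have h1 := hg.strictMonoOn.monotoneOn (Set.left_mem_Icc.2 hab.le) hx hx.1
  have h2 := hg.strictMonoOn.monotoneOn hx (Set.right_mem_Icc.2 hab.le) hx.2
  rw [hg.map_left] at h1
  rw [hg.map_right] at h2
  exact ⟨h1, h2⟩

lemma IsTimeChange.exists_apply_eq (hab : a < b) (hg : IsTimeChange a b g)
    (hx : x ∈ Set.Icc a b) : ∃ s ∈ Set.Icc a b, g s = x := by
  have := intermediate_value_Icc hab.le hg.continuousOn
  rw [hg.map_left, hg.map_right] at this
  exact this hx

lemma IsTimeChange.inv_mem_Icc (hab : a < b) (hg : IsTimeChange a b g) (hx : x ∈ Set.Icc a b) :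
    inv a b g x ∈ Set.Icc a b :=
  Function.invFunOn_mem (hg.exists_apply_eq hab hx)

lemma IsTimeChange.apply_inv (hab : a < b) (hg : IsTimeChange a b g) (hx : x ∈ Set.Icc a b) :
    g (inv a b g x) = x :=
  Function.invFunOn_eq (hg.exists_apply_eq hab hx)

/-- The inverse of `f ∘ g⁻¹` is `g ∘ f⁻¹`. -/
lemma IsTimeChange.inv_comp_inv (hab : a < b) (hg : IsTimeChange a b g)
    (hf : Set.InjOn f (Set.Icc a b)) (hx : x ∈ Set.Icc a b) :
    inv a b (f ∘ inv a b g) (f x) = g x := by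
  have hgx := hg.mem_Icc hab hx
  have hval : (f ∘ inv a b g) (g x) = f x := by
    rw [Function.comp_apply, inv_apply hg.strictMonoOn.injOn hx]
  have hinj : Set.InjOn (f ∘ inv a b g) (Set.Icc a b) := by
    intro s hs r hr hsr
    have := hf (hg.inv_mem_Icc hab hs) (hg.inv_mem_Icc hab hr) hsr
    rw [← hg.apply_inv hab hs, ← hg.apply_inv hab hr, this]
  rw [← hval, inv_apply hinj hgx]

end Inverse

/-! ### The nearest observation time -/

section Nearest

variable {a b : ℝ} {f g : ℝ → ℝ} {x τ : ℝ} {n : ℕ} {t : Fin n → ℝ}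

lemma IsEquidistant.mem_Icc (ht : IsEquidistant a b t) (j : Fin n) : t j ∈ Set.Icc a b := by
  obtain ⟨s, d, hd, has, -, -, hsb, hj⟩ := ht
  have h1 : (0 : ℝ) ≤ (j : ℕ) := Nat.cast_nonneg _
  have h2 : ((j : ℕ) : ℝ) + 1 ≤ n := by exact_mod_cast j.2
  rw [hj]
  constructor <;> nlinarith

/-- A nearest time is at most one spacing away from `g x`: if `t j` were
further away, then the neighbouring time on the side of `g x` would still be beyond `g x`, hence
have a value strictly closer to `f x`. -/
lemma IsNearestTime.abs_sub_le (hab : a < b) (hg : IsTimeChange a b g)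
    (hf : StrictMonoOn f (Set.Icc a b)) (hx : x ∈ Set.Icc a b) (ht : IsEquidistant a b t)
    (hn : 2 ≤ n) (hτ : IsNearestTime t (fun j => f (inv a b g (t j))) (f x) τ) :
    |τ - g x| ≤ (b - a) / ((n : ℝ) - 1) := by
  obtain ⟨j, hmin, rfl⟩ := hτ
  have hmem := ht.mem_Icc
  obtain ⟨s, d, hd, has, hsa, hbs, hsb, hj⟩ := ht
  have hn' : (2 : ℝ) ≤ n := by exact_mod_cast hn
  have hgx := hg.mem_Icc hab hx
  have hlt : ∀ {p q : ℝ}, p ∈ Set.Icc a b → q ∈ Set.Icc a b → g p < g q → f p < f q :=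
    fun hp hq h => hf hp hq ((hg.strictMonoOn.lt_iff_lt hp hq).1 h)
  have hinv := fun k => hg.inv_mem_Icc hab (hmem k)
  have happ := fun k => hg.apply_inv hab (hmem k)
  suffices h : |t j - g x| ≤ d by
    refine h.trans ((le_div_iff₀ (by linarith)).2 ?_)
    linarith
  rw [abs_le]
  constructor
  · by_contra! hfar
    have hjn : (j : ℕ) + 1 < n := by
      by_contra! hle
      have hjeq : ((j : ℕ) : ℝ) = n - 1 := by
        rw [eq_sub_iff_add_eq]
        exact_mod_cast le_antisymm j.2 hle
      have := hj j
      rw [hjeq] at this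
      linarith [hgx.2]
    have hk := hj ⟨(j : ℕ) + 1, hjn⟩
    have hjj := hj j
    push_cast at hk
    have h1 : f (inv a b g (t j)) < f (inv a b g (t ⟨(j : ℕ) + 1, hjn⟩)) :=
      hlt (hinv _) (hinv _) (by rw [happ, happ]; linarith)
    have h2 : f (inv a b g (t ⟨(j : ℕ) + 1, hjn⟩)) < f x :=
      hlt (hinv _) hx (by rw [happ]; linarith)
    have h3 := hmin ⟨(j : ℕ) + 1, hjn⟩
    rw [abs_of_neg (by linarith), abs_of_neg (by linarith)] at h3
    linarith
  · by_contra! hfar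
    obtain ⟨j, hjlt⟩ := j
    rcases j with - | k
    · have := hj ⟨0, hjlt⟩
      push_cast at this
      linarith [hgx.1]
    have hk := hj ⟨k, by omega⟩
    have hjj := hj ⟨k + 1, hjlt⟩
    push_cast at hk hjj
    have h1 : f (inv a b g (t ⟨k, by omega⟩)) < f (inv a b g (t ⟨k + 1, hjlt⟩)) :=
      hlt (hinv _) (hinv _) (by rw [happ, happ]; linarith)
    have h2 : f x < f (inv a b g (t ⟨k, by omega⟩)) :=
      hlt hx (hinv _) (by rw [happ]; linarith)
    have h3 := hmin ⟨k, by omega⟩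
    rw [abs_of_pos (by linarith), abs_of_pos (by linarith)] at h3
    linarith

/-- If `g x` is itself an observation time, it is the only nearest time. -/
lemma IsNearestTime.eq_of_mem (hab : a < b) (hg : IsTimeChange a b g)
    (hf : Set.InjOn f (Set.Icc a b)) (hx : x ∈ Set.Icc a b) (ht : ∀ j, t j ∈ Set.Icc a b)
    (hτ : IsNearestTime t (fun j => f (inv a b g (t j))) (f x) τ) (hmem : ∃ j, t j = g x) :
    τ = g x := by
  obtain ⟨j, hmin, rfl⟩ := hτ
  obtain ⟨k, hk⟩ := hmem
  have h := hmin k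
  simp only [hk, inv_apply hg.strictMonoOn.injOn hx, sub_self, abs_zero] at h
  have h0 := sub_eq_zero.1 (abs_nonpos_iff.1 h)
  rw [← hf (hg.inv_mem_Icc hab (ht j)) hx h0, hg.apply_inv hab (ht j)]

end Nearest

/-! ### Warping paths and their mean -/

section Paths

variable {a b : ℝ} {hab : a < b}

lemma continuous_path (hab : a < b) (w : C(Set.Icc a b, ℝ)) : Continuous (path hab w) :=
  w.continuous.Icc_extend'

lemma path_of_mem (hab : a < b) (w : C(Set.Icc a b, ℝ)) {x : ℝ} (hx : x ∈ Set.Icc a b) :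
    path hab w x = w ⟨x, hx⟩ :=
  Set.IccExtend_of_mem _ _ hx

lemma IsWarp.isTimeChange {w : C(Set.Icc a b, ℝ)} (hw : IsWarp hab w) :
    IsTimeChange a b (path hab w) where
  strictMonoOn x hx y hy hxy := by
    rw [path_of_mem hab w hx, path_of_mem hab w hy]
    exact hw.1 hxy
  continuousOn := (continuous_path hab w).continuousOn
  map_left := by rw [path_of_mem hab w (Set.left_mem_Icc.2 hab.le)]; exact hw.2.1
  map_right := by rw [path_of_mem hab w (Set.right_mem_Icc.2 hab.le)]; exact hw.2.2

lemma IsWarp.path_mem_Icc {w : C(Set.Icc a b, ℝ)} (hw : IsWarp hab w) (x : ℝ) :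
    path hab w x ∈ Set.Icc a b := by
  have h := hw.isTimeChange.mem_Icc hab (Set.projIcc a b hab.le x).2
  rwa [path_of_mem hab w (Set.projIcc a b hab.le x).2] at h

/-- A continuous function is strictly increasing as soon as it is so on a dense subset. -/
lemma strictMono_of_dense {w : C(Set.Icc a b, ℝ)} {D : Set (Set.Icc a b)} (hD : Dense D)
    (hw : ∀ p ∈ D, ∀ q ∈ D, p < q → w p < w q) : StrictMono w := by
  intro s r hsr
  obtain ⟨p, hpD, hsp, hpr⟩ := hD.exists_between hsr
  obtain ⟨q, hqD, hpq, hqr⟩ := hD.exists_between hpr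
  have h1 : w s ≤ w p := by
    by_contra! hlt
    obtain ⟨z, hzD, hz⟩ := hD.exists_mem_open
      ((isOpen_lt continuous_const w.continuous).inter isOpen_Iio) ⟨s, hlt, hsp⟩
    exact lt_asymm hz.1 (hw z hzD p hpD hz.2)
  have h2 : w q ≤ w r := by
    by_contra! hlt
    obtain ⟨z, hzD, hz⟩ := hD.exists_mem_open
      ((isOpen_lt w.continuous continuous_const).inter isOpen_Ioi) ⟨r, hlt, hqr⟩
    exact lt_asymm hz.1 (hw q hqD z hzD hz.2)
  exact (h1.trans_lt (hw p hpD q hqD hpq)).trans_le h2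

variable [MeasurableSpace C(Set.Icc a b, ℝ)] [BorelSpace C(Set.Icc a b, ℝ)]

lemma measurable_path (hab : a < b) (x : ℝ) :
    Measurable fun w : C(Set.Icc a b, ℝ) => path hab w x :=
  (continuous_eval_const (Set.projIcc a b hab.le x)).measurable

/-- Being a warp is a measurable property, since by density it can be tested on countably many
pairs of points. -/
lemma measurableSet_isWarp (hab : a < b) :
    MeasurableSet {w : C(Set.Icc a b, ℝ) | IsWarp hab w} := by
  obtain ⟨D, hDc, hD⟩ := TopologicalSpace.exists_countable_dense (Set.Icc a b)
  have heval : ∀ p : Set.Icc a b, Measurable fun w : C(Set.Icc a b, ℝ) => w p :=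
    fun p => (continuous_eval_const p).measurable
  have hset : {w : C(Set.Icc a b, ℝ) | IsWarp hab w} =
      (⋂ p ∈ D, ⋂ q ∈ D, {w | p < q → w p < w q}) ∩
        ({w | w ⟨a, Set.left_mem_Icc.2 hab.le⟩ = a} ∩
          {w | w ⟨b, Set.right_mem_Icc.2 hab.le⟩ = b}) := by
    ext w
    simp only [Set.mem_inter_iff, Set.mem_iInter, Set.mem_ofPred_eq, IsWarp]
    exact and_congr_left fun _ =>
      ⟨fun h p _ q _ hpq => h hpq, fun h => strictMono_of_dense hD h⟩
  rw [hset]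
  refine (MeasurableSet.biInter hDc fun p _ => MeasurableSet.biInter hDc fun q _ => ?_).inter
    ((heval _ (measurableSet_singleton a)).inter (heval _ (measurableSet_singleton b)))
  by_cases hpq : p < q
  · simpa only [hpq, true_imp_iff] using measurableSet_lt (heval p) (heval q)
  · simp only [hpq, false_imp_iff, Set.ofPred_true, MeasurableSet.univ]

variable {Ω : Type*} [MeasurableSpace Ω] {P : Measure Ω} [IsProbabilityMeasure P]
  {H : Ω → C(Set.Icc a b, ℝ)}

lemma integrable_path (hH : AEMeasurable H P) (hwarp : ∀ᵐ ω ∂P, IsWarp hab (H ω)) (x : ℝ) :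
    Integrable (fun ω => path hab (H ω) x) P :=
  (memLp_of_bounded (hwarp.mono fun _ hω => hω.path_mem_Icc x)
    ((measurable_path hab x).comp_aemeasurable hH).aestronglyMeasurable 1).integrable le_rfl

/-- The mean of a warping process is again a strictly increasing continuous function fixing the end
points. -/
lemma isTimeChange_meanWarp (hH : AEMeasurable H P) (hwarp : ∀ᵐ ω ∂P, IsWarp hab (H ω)) :
    IsTimeChange a b (meanWarp P hab H) where
  strictMonoOn x hx y hy hxy := by
    have hlt : ∀ᵐ ω ∂P, path hab (H ω) x < path hab (H ω) y :=
      hwarp.mono fun _ hω => hω.isTimeChange.strictMonoOn hx hy hxy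
    have hx' := integrable_path hH hwarp x
    have hy' := integrable_path hH hwarp y
    refine lt_of_le_of_ne (integral_mono_ae hx' hy' (hlt.mono fun _ => le_of_lt)) fun heq => ?_
    have hzero := (integral_eq_iff_of_ae_le hx' hy' (hlt.mono fun _ => le_of_lt)).1 heq
    obtain ⟨ω, hω, hω'⟩ := (hlt.and hzero).exists
    exact hω.ne hω'
  continuousOn := by
    refine (continuous_of_dominated (bound := fun _ => max |a| |b|)
      (fun x => (integrable_path hH hwarp x).aestronglyMeasurable) (fun x => ?_)
      (integrable_const _) (ae_of_all _ fun ω => continuous_path hab (H ω))).continuousOn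
    filter_upwards [hwarp] with ω hω
    exact abs_le_max_abs_abs (hω.path_mem_Icc x).1 (hω.path_mem_Icc x).2
  map_left := by
    have h : ∀ᵐ ω ∂P, path hab (H ω) a = a := hwarp.mono fun _ hω => hω.isTimeChange.map_left
    rw [meanWarp, integral_congr_ae h]
    simp
  map_right := by
    have h : ∀ᵐ ω ∂P, path hab (H ω) b = b := hwarp.mono fun _ hω => hω.isTimeChange.map_right
    rw [meanWarp, integral_congr_ae h]
    simp

end Paths

/-! ### Spacing of the observation times and degenerate data -/

/-- The exponent `1 / 2 + β` makes the spacing of the observation times `o(m ^ (-1/2))`. -/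
lemma tendsto_sqrt_mul_spacing {n : ℕ → ℕ} {β c : ℝ} (hβ : 0 < β) (hc : 0 < c)
    (hn : ∀ᶠ m : ℕ in atTop, c * (m : ℝ) ^ (1 / 2 + β) ≤ (n m : ℝ)) (L : ℝ) :
    (∀ᶠ m in atTop, 2 ≤ n m) ∧
      Tendsto (fun m : ℕ => √(m : ℝ) * (L / ((n m : ℝ) - 1))) atTop (𝓝 0) := by
  have hpow : Tendsto (fun m : ℕ => c * (m : ℝ) ^ (1 / 2 + β)) atTop atTop :=
    ((tendsto_rpow_atTop (by positivity)).comp tendsto_natCast_atTop_atTop).const_mul_atTop hc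
  have hn2 : ∀ᶠ m in atTop, 2 ≤ n m := by
    filter_upwards [hn, hpow.eventually_ge_atTop 2] with m h1 h2
    exact_mod_cast h2.trans h1
  refine ⟨hn2, ?_⟩
  have hlim : Tendsto (fun m : ℕ => 2 * |L| / c * (m : ℝ) ^ (-β)) atTop (𝓝 0) := by
    simpa using ((tendsto_rpow_neg_atTop hβ).comp
      (tendsto_natCast_atTop_atTop (R := ℝ))).const_mul (2 * |L| / c)
  refine squeeze_zero_norm' ?_ hlim
  filter_upwards [hn, hn2, eventually_ge_atTop 1] with m h1 h2 hm
  have hm' : (0 : ℝ) < m := by exact_mod_cast hm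
  have h2' : (2 : ℝ) ≤ n m := by exact_mod_cast h2
  rw [Real.norm_eq_abs, abs_mul, abs_div, abs_of_nonneg (Real.sqrt_nonneg _),
    abs_of_pos (show (0 : ℝ) < n m - 1 by linarith), ← mul_div_assoc,
    div_le_iff₀ (show (0 : ℝ) < n m - 1 by linarith)]
  have hsplit : (m : ℝ) ^ (1 / 2 + β) = √(m : ℝ) * (m : ℝ) ^ β := by
    rw [Real.rpow_add hm', Real.sqrt_eq_rpow]
  have hcancel : (m : ℝ) ^ (-β) * (m : ℝ) ^ β = 1 := by
    rw [← Real.rpow_add hm', neg_add_cancel, Real.rpow_zero]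
  rw [hsplit] at h1
  -- `n - 1 ≥ n / 2`, and `n ≥ c * √m * m ^ β`
  calc √(m : ℝ) * |L|
      = 2 * |L| / c * (m : ℝ) ^ (-β) * (c * (√(m : ℝ) * (m : ℝ) ^ β) / 2) := by
        field_simp
        linear_combination (-|L|) * hcancel
    _ ≤ 2 * |L| / c * (m : ℝ) ^ (-β) * ((n m : ℝ) - 1) :=
        mul_le_mul_of_nonneg_left (by linarith) (by positivity)

/-- For constant data the empirical variance is zero and the interval is the common value. -/
lemma mem_confInterval_of_eq (α : ℝ) {m : ℕ} (hm : 1 ≤ m) {x : ℕ → ℝ} {θ : ℝ}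
    (h : ∀ i < m, x i = θ) : θ ∈ confInterval α m x := by
  have hm' : (m : ℝ) ≠ 0 := by exact_mod_cast (Nat.one_le_iff_ne_zero.1 hm)
  have hmean : invEst m x = θ := by
    rw [invEst, Finset.sum_congr rfl fun i hi => h i (Finset.mem_range.1 hi)]
    simp [hm']
  have hsq : secondMomentEst m x = θ ^ 2 := by
    rw [secondMomentEst, Finset.sum_congr rfl fun i hi => by rw [h i (Finset.mem_range.1 hi)]]
    simp [hm']
  simp [confInterval, varEst, hmean, hsq]

end Warping

theorem corollary2p4
    {Ω : Type*} [MeasurableSpace Ω] (P : Measure Ω) [IsProbabilityMeasure P]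
    {a b : ℝ} (hab : a < b)
    [MeasurableSpace C(Set.Icc a b, ℝ)] [BorelSpace C(Set.Icc a b, ℝ)]
    -- the warping process `H` and the i.i.d. copies `h 0, h 1, …`
    (H : Ω → C(Set.Icc a b, ℝ)) (hH : ∀ᵐ ω ∂P, Warping.IsWarp hab (H ω))
    (h : ℕ → Ω → C(Set.Icc a b, ℝ))
    (h_indep : iIndepFun h P) (h_law : ∀ i, IdentDistrib (h i) H P P)
    -- the pattern
    (f : ℝ → ℝ) (hf_mono : StrictMonoOn f (Set.Icc a b)) (hf_cont : ContinuousOn f (Set.Icc a b))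
    -- the number of observation times per curve when there are `m` curves
    (n : ℕ → ℕ) (β c : ℝ) (hβ : 0 < β) (hc : 0 < c)
    (hn : ∀ᶠ m : ℕ in atTop, c * (m : ℝ) ^ (1 / 2 + β) ≤ (n m : ℝ))
    -- the observation times `t m i j` of the curve `i`
    (t : (m : ℕ) → ℕ → Fin (n m) → ℝ)
    (ht : ∀ m, 1 ≤ m → ∀ i < m, Warping.IsEquidistant a b (t m i))
    -- `T m i y ω` is an observation time at which the curve `f ∘ (h i ω)⁻¹` is nearest to `y`
    (T : ℕ → ℕ → ℝ → Ω → ℝ)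
    (hT : ∀ m, 1 ≤ m → ∀ i < m, ∀ y ∈ Set.Icc (f a) (f b), ∀ ω,
      Warping.IsNearestTime (t m i)
        (fun j => f (Warping.inv a b (Warping.path hab (h i ω)) (t m i j))) y (T m i y ω))
    (α : ℝ) (hα : α ∈ Set.Ioo (0 : ℝ) 1) :
    -- the coverage probability tends to `1 - α` wherever the limit variance is positive
    (∀ y ∈ Set.Icc (f a) (f b),
      0 < variance (fun ω => Warping.path hab (H ω) (Warping.inv a b f y)) P →
      Tendsto
        (fun m : ℕ => P.real {ω | Warping.inv a b (Warping.structuralExpectation P hab H f) y ∈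
          Warping.confInterval α m (fun i => T m i y ω)})
        atTop (𝓝 (1 - α))) ∧
    -- at the two end points it is one as soon as the observation times contain `a` and `b`
    (∀ m, 1 ≤ m → (∀ i < m, (∃ j, t m i j = a) ∧ (∃ j, t m i j = b)) →
      ∀ y, y = f a ∨ y = f b →
        P.real {ω | Warping.inv a b (Warping.structuralExpectation P hab H f) y ∈
          Warping.confInterval α m (fun i => T m i y ω)} = 1) := by
  have ha := Set.left_mem_Icc.2 hab.le
  have hb := Set.right_mem_Icc.2 hab.le
  have hHm : AEMeasurable H P := (h_law 0).aemeasurable_snd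
  have hφ := Warping.isTimeChange_meanWarp hHm hH
  have hwarp : ∀ᵐ ω ∂P, ∀ i, Warping.IsWarp hab (h i ω) :=
    ae_all_iff.2 fun i => (h_law i).symm.ae_snd (Warping.measurableSet_isWarp hab) hH
  have hmemf : ∀ x ∈ Set.Icc a b, f x ∈ Set.Icc (f a) (f b) := fun x hx =>
    ⟨hf_mono.monotoneOn ha hx hx.1, hf_mono.monotoneOn hx hb hx.2⟩
  have hES : ∀ x ∈ Set.Icc a b, Warping.inv a b (Warping.structuralExpectation P hab H f) (f x) =
      Warping.meanWarp P hab H x :=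
    fun x hx => hφ.inv_comp_inv hab hf_mono.injOn hx
  constructor
  · intro y hy hvar
    obtain ⟨x, hx, rfl⟩ := intermediate_value_Icc hab.le hf_cont hy
    rw [Warping.inv_apply hf_mono.injOn hx] at hvar
    rw [hES x hx]
    have hlaw : ∀ i, IdentDistrib (fun ω => Warping.path hab (h i ω) x)
        (fun ω => Warping.path hab (H ω) x) P P :=
      fun i => (h_law i).comp (Warping.measurable_path hab x)
    obtain ⟨hn2, hδ⟩ := Warping.tendsto_sqrt_mul_spacing hβ hc hn (b - a)
    rw [← (hlaw 0).variance_eq] at hvar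
    rw [Warping.meanWarp, ← (hlaw 0).integral_eq]
    refine Warping.tendsto_measureReal_mem_confInterval (C := max |a| |b|)
      (X := fun i ω => Warping.path hab (h i ω) x) (τ := fun m i ω => T m i (f x) ω)
      (h_indep.comp (fun _ w => Warping.path hab w x) fun _ => Warping.measurable_path hab x)
      (fun i => (hlaw i).trans (hlaw 0).symm) (fun i => ?_) hvar hδ ?_ hα
    · filter_upwards [hwarp] with ω hω
      exact abs_le_max_abs_abs ((hω i).path_mem_Icc x).1 ((hω i).path_mem_Icc x).2
    · filter_upwards [hn2, eventually_ge_atTop 1] with m hm2 hm1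
      filter_upwards [hwarp] with ω hω i hi
      have hnear := hT m hm1 i hi (f x) (hmemf x hx) ω
      refine ⟨?_, hnear.abs_sub_le hab (hω i).isTimeChange hf_mono hx (ht m hm1 i hi) hm2⟩
      obtain ⟨j, -, hj⟩ := hnear
      rw [hj]
      have hmem := (ht m hm1 i hi).mem_Icc j
      exact abs_le_max_abs_abs hmem.1 hmem.2
  · intro m hm htab y hy
    obtain ⟨x, hx, rfl, hxab⟩ : ∃ x ∈ Set.Icc a b, f x = y ∧ (x = a ∨ x = b) := by
      rcases hy with rfl | rfl
      · exact ⟨a, ha, rfl, Or.inl rfl⟩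
      · exact ⟨b, hb, rfl, Or.inr rfl⟩
    have hfix : ∀ g, Warping.IsTimeChange a b g → g x = x := by
      rintro g hg
      rcases hxab with rfl | rfl
      · exact hg.map_left
      · exact hg.map_right
    rw [hES x hx, hfix _ hφ]
    have hae : ∀ᵐ ω ∂P, x ∈ Warping.confInterval α m (fun i => T m i (f x) ω) := by
      filter_upwards [hwarp] with ω hω
      refine Warping.mem_confInterval_of_eq α hm fun i hi => ?_
      have hgi := hfix _ (hω i).isTimeChange
      rw [(hT m hm i hi (f x) (hmemf x hx) ω).eq_of_mem hab (hω i).isTimeChange hf_mono.injOn hx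
        (ht m hm i hi).mem_Icc ?_, hgi]
      rw [hgi]
      rcases hxab with rfl | rfl
      · exact (htab i hi).1
      · exact (htab i hi).2
    rw [measureReal_def, measure_congr (eventuallyEq_univ.2 hae)]
    simp
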